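/- Setting. A discrete large sample (Bayesian) estimation problem consists of a countable parameter space $\Theta\subset\mathbb R^d$, countable non-empty sets $X_1,X_2,\dots$, each a subset of some Euclidean space, pairwise distinct probability distributions $P_\theta$ ($\theta\in\Theta$) on $X=\prod_{i\ge1}X_i$ (with the $\sigma$-algebra generated by the cylinders $\{x: x_i=a\}$), and a prior distribution $\Pi$ on $\Theta$ with $\Pi(\{\theta\})>0$ for all $\theta$. Write $X_{1:n}=X_1\times\dots\times X_n$, let $P_\theta^{(1:n)}(y)$ be the $P_\theta$-probability that the first $n$ observations equal $y$, and let $p_n(y)=\sum_{\theta}\Pi(\{\theta\})P_\theta^{(1:n)}(y)$ for $y\in X_{1:n}$. The problem has distinctive likelihoods if for every $\theta\in\Theta$ and every neighbourhood $U$ of $\theta$ in $\Theta$, for $P_\theta$-almost every $x\in X$, $$\limsup_{n\to\infty}\frac{\sup_{\theta'\in\Theta\setminus U}P_{\theta'}^{(1:n)}(x_{1:n})}{\sup_{\tilde\theta\in U}P_{\tilde\theta}^{(1:n)}(x_{1:n})}<1 .$$ An estimator is a sequence of functions $\hat\theta_n:X_{1:n}\to\Theta$. It is consistent if for every $\theta\in\Theta$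 and every neighbourhood $U$ of $\theta$, $P_\theta(\hat\theta_n(x_{1:n})\in U)\to1$ as $n\to\infty$; otherwise it is inconsistent. For $F:X_{1:n}\to\Theta$, let $q_F(\theta)=\sum_{y:F(y)=\theta}p_n(y)$. The excess expected message length of $F$ is $$I_2(F)=-\sum_{\theta\in\Theta}q_F(\theta)\log q_F(\theta)+\sum_{y\in X_{1:n}}p_n(y)\log\frac{p_n(y)}{P^{(1:n)}_{F(y)}(y)},$$ where $0\log 0=0$, terms with $p_n(y)=0$ are $0$, and terms with $p_n(y)>0=P^{(1:n)}_{F(y)}(y)$ are $+\infty$ (if the expression takes the form $\infty-\infty$, the two series are added term by term over $y$, that is, $I_2(F)=\sum_{y}p_n(y)\log\frac{p_n(y)}{q_F(F(y))P^{(1:n)}_{F(y)}(y)}$). An estimator $(\hat\theta_n)$ is a Strict Minimum Message Length (SMML) estimator if for every $n\ge1$, $I_2(\hat\theta_n)=\inf_{F:X_{1:n}\to\Theta}I_2(F)$. Theorem. The class of SMML estimators is not partially consistent over the class of discrete large sample estimation problems with distinctive likelihoods; that is, it is not true that on every such problem all SMML estimators are consistent. In fact, there is a discrete large sample estimation problem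 with distinctive likelihoods on which SMML estimators exist and every SMML estimator is inconsistent. -/

import Mathlib

open MeasureTheory Filter Topology
open scoped ENNReal

noncomputable section

/-- A discrete, large sample, Bayesian estimation problem. The parameter space `Param` and the
single-observation spaces `Obs n` are countable subsets of Euclidean spaces, hence every subset of
them is measurable, and the product σ-algebra on `∀ n, Obs n` is the one generated by the
cylinders `{x | x i = a}`. Observations are indexed from `0`. Non-emptiness of `Param` and of each
`Obs n` is forced by the existence of the prior and of the probability measures `law θ`. -/
structure EstimationProblem where
  /-- dimension of the Euclidean space containing the parameter space -/
  paramDim : ℕ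
  /-- the parameter space `Θ` -/
  Param : Set (EuclideanSpace ℝ (Fin paramDim))
  countable_param : Param.Countable
  /-- dimension of the Euclidean space containing the values of the `n`-th observation -/
  obsDim : ℕ → ℕ
  /-- the set of values of the `n`-th observation -/
  Obs : ∀ n, Set (EuclideanSpace ℝ (Fin (obsDim n)))
  countable_obs : ∀ n, (Obs n).Countable
  /-- the distribution `P_θ` of the infinite sequence of observations -/
  law : Param → Measure (∀ n, Obs n)
  isProbabilityMeasure_law : ∀ θ, IsProbabilityMeasure (law θ)
  law_injective : Function.Injective law
  /-- the prior distribution on the parameter space -/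
  prior : PMF Param
  prior_pos : ∀ θ, 0 < prior θ

namespace EstimationProblem

variable (T : EstimationProblem)

/-- Possible values of the first `n` observations. -/
abbrev Sample (n : ℕ) : Type := ∀ i : Fin n, T.Obs i

/-- The first `n` terms of an infinite sequence of observations. -/
def firstObs (n : ℕ) (x : ∀ k, T.Obs k) : T.Sample n := fun i => x i

/-- The likelihood: the probability that the first `n` observations are `y`, given `θ`. -/
def likelihood (n : ℕ) (θ : T.Param) (y : T.Sample n) : ℝ≥0∞ :=
  T.law θ {x | T.firstObs n x = y}

/-- The unconditional probability that the first `n` observations are `y`. -/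
def marginal (n : ℕ) (y : T.Sample n) : ℝ≥0∞ :=
  ∑' θ, T.prior θ * T.likelihood n θ y

/-- An estimator: for every `n`, a function of the first `n` observations. -/
abbrev Estimator : Type := ∀ n, T.Sample n → T.Param

variable {T}

/-- Convergence in probability of the estimates to `θ` when `θ` is the true parameter. -/
def IsConsistentAt (est : T.Estimator) (θ : T.Param) : Prop :=
  ∀ U ∈ 𝓝 θ, Tendsto (fun n => T.law θ {x | est n (T.firstObs n x) ∈ U}) atTop (𝓝 1)

/-- Consistency at every parameter. -/
def IsConsistent (est : T.Estimator) : Prop := ∀ θ, IsConsistentAt est θ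

variable (T)

/-- Distinctive likelihoods. Under `T.law θ` the likelihood of `θ` is almost surely positive for
all `n`, so the denominator almost surely does not vanish; a supremum over the empty set is `0`. -/
def HasDistinctiveLikelihoods : Prop :=
  ∀ θ : T.Param, ∀ U ∈ 𝓝 θ, ∀ᵐ x ∂(T.law θ),
    limsup (fun n => (⨆ θ' ∈ Uᶜ, T.likelihood n θ' (T.firstObs n x)) /
      (⨆ θ' ∈ U, T.likelihood n θ' (T.firstObs n x))) atTop < 1

variable {T}

open Classical in
/-- The unconditional probability that the estimate `F` based on `n` observations equals `θ`. -/
def estimateProb (n : ℕ) (F : T.Sample n → T.Param) (θ : T.Param) : ℝ≥0∞ :=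
  ∑' y, if F y = θ then T.marginal n y else 0

/-- Shannon entropy of the estimate, `- ∑ q log q`, with values in `[0, ∞]`. -/
def estimateEntropy (n : ℕ) (F : T.Sample n → T.Param) : ℝ≥0∞ :=
  ∑' θ, ENNReal.ofReal (Real.negMulLog (estimateProb n F θ).toReal)

/-- The sum of a family of extended reals: sum of positive parts minus sum of negative parts. -/
def extendedSum {ι : Type} (f : ι → EReal) : EReal :=
  ((∑' i, (f i).toENNReal : ℝ≥0∞) : EReal) - ((∑' i, (-f i).toENNReal : ℝ≥0∞) : EReal)

/-- `p(y) log (p(y) / P_{F(y)}(y))` where `p` is the marginal distribution of the sample. It is `0`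
if `p(y) = 0`, and `+∞` if `p(y) > 0` and `P_{F(y)}(y) = 0`. -/
def excessTerm (n : ℕ) (F : T.Sample n → T.Param) (y : T.Sample n) : EReal :=
  (T.marginal n y : EReal) * ENNReal.log (T.marginal n y / T.likelihood n (F y) y)

open Classical in
/-- The excess expected message length `I₂`: the entropy of the estimate plus the sum of the
`excessTerm`s. The negative parts of these terms can have an infinite sum only if the entropy of
the estimate is infinite as well. In that case, where the expression reads `∞ - ∞`, the entropy is
written as `∑ p(y) (-log q(F y))`, with `q` the distribution of the estimate, and the two series
are added term by term; the negative parts of the terms of the combined series always have a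
finite sum. -/
def excessMessageLength (n : ℕ) (F : T.Sample n → T.Param) : EReal :=
  if ∑' y, (-excessTerm n F y).toENNReal ≠ ∞ then
    (estimateEntropy n F : EReal) + extendedSum (excessTerm n F)
  else
    extendedSum fun y =>
      (T.marginal n y : EReal) * -ENNReal.log (estimateProb n F (F y)) + excessTerm n F y

/-- Strict minimum message length estimators: for every number `n ≥ 1` of observations, the
excess expected message length is minimal among all functions from samples to parameters. -/
def IsSMML (est : T.Estimator) : Prop :=
  ∀ n, 1 ≤ n → excessMessageLength n (est n) =
    ⨅ F : T.Sample n → T.Param, excessMessageLength n F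

end EstimationProblem

open EstimationProblem

/-- An estimator class: a set of estimators on every estimation problem. -/
abbrev EstimatorClass : Type := ∀ T : EstimationProblem, Set T.Estimator

/-- The class of strict minimum message length estimators. -/
def smmlClass : EstimatorClass := fun _ => {est | IsSMML est}

/-- Every estimator of the class `E` on a problem of the class `C` is consistent. -/
def EstimatorClass.PartiallyConsistentOver (E : EstimatorClass) (C : Set EstimationProblem) :
    Prop :=
  ∀ T ∈ C, ∀ est ∈ E T, IsConsistent est

end

/-! ### Likelihoods, marginals and estimate probabilities as probability masses. -/

namespace EstimationProblem

variable {T : EstimationProblem}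

/-! The counterexample makes one useless parameter always optimal. Law 0 produces a geometric number
of ones, then zeros forever. Law `m ≥ 1` draws from the normalized prior mixture of laws `0, ..., m
- 1` and overwrites everything from time `m` on by `m`. Hence for `n ≥ 1` all laws with index at
least `n` agree on the first `n` observations, and their common value there is the marginal
(`seqLaw_cylinder_eq`, `tsum_weight_mul_seqLaw_cylinder`).

By Gibbs' inequality (`excessMessageLength_nonneg_and_eq`) the message length is nonnegative. The
constant estimate `n` attains 0, so SMML means zero excess, that is, `p(y) = q(F y) P_{F y}(y)`
wherever `p(y) > 0`. If 0 were an estimate of positive probability, `p` would be proportional to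
`P_0` on the support of `P_0` (`eq_and_marginal_eq_of_optimal`). The all-zeros and all-ones samples
refute this, since law 1 also generates the latter. So for `n ≥ 2` the estimate is almost surely
never 0, although 0 is an isolated parameter.

Likelihoods are distinctive because the observations of law `m` are eventually all `m`, which leaves
every other law at most 2/3 of its likelihood (`three_mul_seqLaw_cylinder_le`). -/

instance countable_obs_type (n : ℕ) : Countable (T.Obs n) := (T.countable_obs n).to_subtype

instance countable_param_type : Countable T.Param := T.countable_param.to_subtype

theorem measurable_firstObs (n : ℕ) : Measurable (T.firstObs n) :=
  measurable_pi_lambda _ fun i => measurable_pi_apply (i : ℕ)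

/-- The probability of an event depending on the first `n` observations, as a sum. -/
theorem law_firstObs_mem (n : ℕ) (θ : T.Param) (A : Set (T.Sample n)) :
    T.law θ {x | T.firstObs n x ∈ A} = ∑' y, A.indicator (T.likelihood n θ) y := by
  have h := Measure.tsum_indicator_apply_singleton ((T.law θ).map (T.firstObs n)) A
    A.to_countable.measurableSet
  rw [Measure.map_apply (measurable_firstObs n) A.to_countable.measurableSet] at h
  refine h.symm.trans (tsum_congr fun y => ?_)
  by_cases hy : y ∈ A
  · simp only [Set.indicator_of_mem hy]
    rw [Measure.map_apply (measurable_firstObs n) (measurableSet_singleton y)]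
    rfl
  · simp only [Set.indicator_of_notMem hy]

theorem tsum_likelihood (n : ℕ) (θ : T.Param) : ∑' y, T.likelihood n θ y = 1 := by
  have := T.isProbabilityMeasure_law θ
  have h := law_firstObs_mem n θ Set.univ
  simpa using h.symm

theorem likelihood_le_one (n : ℕ) (θ : T.Param) (y : T.Sample n) : T.likelihood n θ y ≤ 1 :=
  (ENNReal.le_tsum y).trans_eq (tsum_likelihood n θ)

theorem likelihood_ne_top (n : ℕ) (θ : T.Param) (y : T.Sample n) : T.likelihood n θ y ≠ ∞ :=
  ((likelihood_le_one n θ y).trans_lt ENNReal.one_lt_top).ne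

theorem tsum_marginal (n : ℕ) : ∑' y, T.marginal n y = 1 := by
  unfold marginal
  rw [ENNReal.tsum_comm]
  simp_rw [ENNReal.tsum_mul_left, tsum_likelihood, mul_one]
  exact T.prior.tsum_coe

theorem marginal_ne_top (n : ℕ) (y : T.Sample n) : T.marginal n y ≠ ∞ :=
  (((ENNReal.le_tsum y).trans_eq (tsum_marginal n)).trans_lt ENNReal.one_lt_top).ne

theorem tsum_estimateProb (n : ℕ) (F : T.Sample n → T.Param) :
    ∑' θ, estimateProb n F θ = 1 := by
  classical
  unfold estimateProb
  rw [ENNReal.tsum_comm, ← tsum_marginal n]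
  refine tsum_congr fun y => ?_
  rw [tsum_eq_single (F y) fun θ h => if_neg (Ne.symm h), if_pos rfl]

theorem estimateProb_le_one (n : ℕ) (F : T.Sample n → T.Param) (θ : T.Param) :
    estimateProb n F θ ≤ 1 :=
  (ENNReal.le_tsum θ).trans_eq (tsum_estimateProb n F)

theorem estimateProb_ne_top (n : ℕ) (F : T.Sample n → T.Param) (θ : T.Param) :
    estimateProb n F θ ≠ ∞ :=
  ((estimateProb_le_one n F θ).trans_lt ENNReal.one_lt_top).ne

theorem marginal_le_estimateProb (n : ℕ) (F : T.Sample n → T.Param) (y : T.Sample n) :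
    T.marginal n y ≤ estimateProb n F (F y) := by
  classical
  unfold estimateProb
  refine le_trans ?_ (ENNReal.le_tsum y)
  rw [if_pos rfl]

/-! ### The message length as a finite real sum when the marginal has finite support. -/

theorem excessTerm_of_marginal_eq_zero {n : ℕ} (F : T.Sample n → T.Param) {y : T.Sample n}
    (h : T.marginal n y = 0) : excessTerm n F y = 0 := by
  simp [excessTerm, h]

theorem excessTerm_ne_bot (n : ℕ) (F : T.Sample n → T.Param) (y : T.Sample n) :
    excessTerm n F y ≠ ⊥ := by
  by_cases h : T.marginal n y = 0
  · simp [excessTerm_of_marginal_eq_zero F h]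
  · unfold excessTerm
    have hd : T.marginal n y / T.likelihood n (F y) y ≠ 0 :=
      (ENNReal.div_pos h (likelihood_ne_top n _ y)).ne'
    have hl : ENNReal.log (T.marginal n y / T.likelihood n (F y) y) ≠ ⊥ := by
      simpa [ENNReal.log_eq_bot_iff] using hd
    have h0 : 0 < (T.marginal n y).toReal := ENNReal.toReal_pos h (marginal_ne_top n y)
    generalize ENNReal.log _ = l at hl ⊢
    rw [← EReal.coe_ennreal_toReal (marginal_ne_top n y)]
    induction l with
    | bot => exact absurd rfl hl
    | top => rw [EReal.coe_mul_top_of_pos h0]; exact bot_ne_top.symm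
    | coe r => rw [← EReal.coe_mul]; exact EReal.coe_ne_bot _

theorem excessTerm_eq_top {n : ℕ} {F : T.Sample n → T.Param} {y : T.Sample n}
    (h : T.marginal n y ≠ 0) (hL : T.likelihood n (F y) y = 0) : excessTerm n F y = ⊤ := by
  unfold excessTerm
  rw [hL, ENNReal.div_zero h, ENNReal.log_top]
  exact EReal.mul_top_of_pos (by simpa using pos_iff_ne_zero.2 h)

theorem excessTerm_eq_coe {n : ℕ} {F : T.Sample n → T.Param} {y : T.Sample n}
    (hL : T.marginal n y ≠ 0 → T.likelihood n (F y) y ≠ 0) :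
    excessTerm n F y = (((T.marginal n y).toReal *
      Real.log ((T.marginal n y).toReal / (T.likelihood n (F y) y).toReal) : ℝ) : EReal) := by
  by_cases h : T.marginal n y = 0
  · simp [excessTerm_of_marginal_eq_zero F h, h]
  · have hd : T.marginal n y / T.likelihood n (F y) y ≠ 0 :=
      (ENNReal.div_pos h (likelihood_ne_top n _ y)).ne'
    have ht : T.marginal n y / T.likelihood n (F y) y ≠ ∞ :=
      ENNReal.div_ne_top (marginal_ne_top n y) (hL h)
    unfold excessTerm
    rw [ENNReal.log_pos_real hd ht, ENNReal.toReal_div, EReal.coe_mul]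
    congr 1
    rw [← EReal.coe_ennreal_toReal (marginal_ne_top n y)]

/-- The sum of a finitely supported family of real numbers, as an `extendedSum`. -/
theorem extendedSum_coe {ι : Type} {s : Finset ι} {f : ι → ℝ} (hf : ∀ i ∉ s, f i = 0) :
    extendedSum (fun i => (f i : EReal)) = ((∑ i ∈ s, f i : ℝ) : EReal) := by
  have key : ∀ g : ι → ℝ, (∀ i ∉ s, g i = 0) →
      ∑' i, ((g i : EReal)).toENNReal = ENNReal.ofReal (∑ i ∈ s, max (g i) 0) := by
    intro g hg
    rw [tsum_eq_sum (s := s) fun i hi => by simp [hg i hi],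
      ENNReal.ofReal_sum_of_nonneg fun i _ => le_max_right _ _]
    refine Finset.sum_congr rfl fun i _ => ?_
    rw [EReal.toENNReal_of_ne_top (EReal.coe_ne_top _), EReal.toReal_coe]
    simp [ENNReal.ofReal_max]
  unfold extendedSum
  simp_rw [← EReal.coe_neg]
  rw [key f hf, key (fun i => -f i) fun i hi => by simp [hf i hi],
    EReal.coe_ennreal_ofReal, EReal.coe_ennreal_ofReal,
    max_eq_left (Finset.sum_nonneg fun i _ => le_max_right _ _),
    max_eq_left (Finset.sum_nonneg fun i _ => le_max_right _ _), ← EReal.coe_sub,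
    ← Finset.sum_sub_distrib]
  congr 1
  refine Finset.sum_congr rfl fun i _ => ?_
  rcases le_total (f i) 0 with h | h
  · rw [max_eq_right h, max_eq_left (by linarith)]; ring
  · rw [max_eq_left h, max_eq_right (by linarith)]; ring

theorem sum_toReal_marginal {n : ℕ} {s : Finset (T.Sample n)}
    (hs : ∀ y ∉ s, T.marginal n y = 0) : ∑ y ∈ s, (T.marginal n y).toReal = 1 := by
  rw [← ENNReal.toReal_sum fun y _ => marginal_ne_top n y, ← ENNReal.toReal_one, ← tsum_marginal n, tsum_eq_sum (s := s) hs]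

open Classical in
theorem toReal_estimateProb {n : ℕ} {s : Finset (T.Sample n)}
    (hs : ∀ y ∉ s, T.marginal n y = 0) (F : T.Sample n → T.Param) (θ : T.Param) :
    (estimateProb n F θ).toReal = ∑ y ∈ s with F y = θ, (T.marginal n y).toReal := by
  unfold estimateProb
  rw [tsum_eq_sum (s := s) fun y hy => by simp [hs y hy], Finset.sum_filter,
    ENNReal.toReal_sum fun y _ => by split_ifs <;> simp [marginal_ne_top]]
  exact Finset.sum_congr rfl fun y _ => by split_ifs <;> simp

/-- Grouping samples by their estimate turns the entropy into a sum over samples. Nonnegativity is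
recorded so that `ENNReal.ofReal` can later be removed. -/
theorem estimateEntropy_eq_ofReal_sum {n : ℕ} {s : Finset (T.Sample n)}
    (hs : ∀ y ∉ s, T.marginal n y = 0) (F : T.Sample n → T.Param) :
    0 ≤ ∑ y ∈ s, -((T.marginal n y).toReal * Real.log (estimateProb n F (F y)).toReal) ∧
    estimateEntropy n F = ENNReal.ofReal
      (∑ y ∈ s, -((T.marginal n y).toReal * Real.log (estimateProb n F (F y)).toReal)) := by
  classical
  have h : ∑ θ ∈ s.image F, Real.negMulLog (estimateProb n F θ).toReal =
      ∑ y ∈ s, -((T.marginal n y).toReal * Real.log (estimateProb n F (F y)).toReal) := by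
    rw [← Finset.sum_fiberwise_of_maps_to (fun y hy => Finset.mem_image_of_mem F hy)]
    refine Finset.sum_congr rfl fun θ _ => ?_
    rw [Real.negMulLog, neg_mul]
    nth_rewrite 1 [toReal_estimateProb hs]
    rw [Finset.sum_mul, ← Finset.sum_neg_distrib]
    refine Finset.sum_congr rfl fun y hy => ?_
    rw [(Finset.mem_filter.1 hy).2]
  have h0 : ∀ θ, 0 ≤ Real.negMulLog (estimateProb n F θ).toReal := fun θ =>
    Real.negMulLog_nonneg ENNReal.toReal_nonneg
      (ENNReal.toReal_mono ENNReal.one_ne_top (estimateProb_le_one n F θ))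
  rw [← h]
  refine ⟨Finset.sum_nonneg fun θ _ => h0 θ, ?_⟩
  unfold estimateEntropy
  rw [ENNReal.ofReal_sum_of_nonneg fun θ _ => h0 θ]
  refine tsum_eq_sum fun θ hθ => ?_
  have : ∑ y ∈ s with F y = θ, (T.marginal n y).toReal = 0 := by
    refine Finset.sum_eq_zero fun y hy => ?_
    rw [Finset.mem_filter] at hy
    exact absurd (Finset.mem_image.2 ⟨y, hy⟩) hθ
  rw [toReal_estimateProb hs, this, Real.negMulLog_zero, ENNReal.ofReal_zero]

/-- A Kraft inequality: each term is one summand of the mixture `∑ θ, q(θ) P_θ(y)`, which has total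
mass 1. -/
theorem sum_estimateProb_mul_likelihood_le_one (n : ℕ) (s : Finset (T.Sample n))
    (F : T.Sample n → T.Param) :
    ∑ y ∈ s, (estimateProb n F (F y)).toReal * (T.likelihood n (F y) y).toReal ≤ 1 := by
  have h : ∑ y ∈ s, estimateProb n F (F y) * T.likelihood n (F y) y ≤ 1 := by
    calc _ ≤ ∑ y ∈ s, ∑' θ, estimateProb n F θ * T.likelihood n θ y :=
          Finset.sum_le_sum fun y _ =>
            ENNReal.le_tsum (f := fun θ => estimateProb n F θ * T.likelihood n θ y) (F y)
      _ ≤ ∑' y, ∑' θ, estimateProb n F θ * T.likelihood n θ y := ENNReal.sum_le_tsum _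
      _ = 1 := by
        rw [ENNReal.tsum_comm]
        simp_rw [ENNReal.tsum_mul_left, tsum_likelihood, mul_one, tsum_estimateProb]
  have h' := ENNReal.toReal_mono ENNReal.one_ne_top h
  rw [ENNReal.toReal_sum fun y _ =>
    ENNReal.mul_ne_top (estimateProb_ne_top _ _ _) (likelihood_ne_top _ _ _)] at h'
  simpa using h'

theorem tsum_neg_excessTerm_ne_top {n : ℕ} {s : Finset (T.Sample n)}
    (hs : ∀ y ∉ s, T.marginal n y = 0) (F : T.Sample n → T.Param) :
    ∑' y, (-excessTerm n F y).toENNReal ≠ ∞ := by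
  rw [tsum_eq_sum (s := s) fun y hy => by simp [excessTerm_of_marginal_eq_zero F (hs y hy)]]
  refine ENNReal.sum_ne_top.2 fun y _ => ?_
  rw [Ne, EReal.toENNReal_eq_top_iff, EReal.neg_eq_top_iff]
  exact excessTerm_ne_bot n F y

theorem excessMessageLength_eq_top {n : ℕ} {s : Finset (T.Sample n)}
    (hs : ∀ y ∉ s, T.marginal n y = 0) {F : T.Sample n → T.Param} {y : T.Sample n}
    (h : T.marginal n y ≠ 0) (hL : T.likelihood n (F y) y = 0) :
    excessMessageLength n F = ⊤ := by
  have hn := tsum_neg_excessTerm_ne_top hs F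
  unfold excessMessageLength extendedSum
  rw [if_pos hn]
  have ht : ∑' y, (excessTerm n F y).toENNReal = ∞ := by
    rw [← top_le_iff]
    refine le_trans ?_ (ENNReal.le_tsum y)
    rw [excessTerm_eq_top h hL, EReal.toENNReal_top]
  rw [ht, ← EReal.coe_ennreal_toReal hn, EReal.coe_ennreal_top, EReal.top_sub_coe]
  exact EReal.add_top_of_ne_bot (EReal.coe_ennreal_ne_bot _)

theorem excessMessageLength_eq_coe_sum {n : ℕ} {s : Finset (T.Sample n)}
    (hs : ∀ y ∉ s, T.marginal n y = 0) {F : T.Sample n → T.Param}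
    (hL : ∀ y, T.marginal n y ≠ 0 → T.likelihood n (F y) y ≠ 0) :
    excessMessageLength n F = ((∑ y ∈ s, (T.marginal n y).toReal *
      (Real.log ((T.marginal n y).toReal / (T.likelihood n (F y) y).toReal) -
        Real.log (estimateProb n F (F y)).toReal) : ℝ) : EReal) := by
  obtain ⟨h0, hE⟩ := estimateEntropy_eq_ofReal_sum hs F
  unfold excessMessageLength
  rw [if_pos (tsum_neg_excessTerm_ne_top hs F), hE,
    show excessTerm n F = _ from funext fun y => excessTerm_eq_coe (hL y),
    extendedSum_coe (s := s) fun y hy => by simp [hs y hy], EReal.coe_ennreal_ofReal,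
    max_eq_left h0, ← EReal.coe_add, ← Finset.sum_add_distrib]
  congr 1
  exact Finset.sum_congr rfl fun y _ => by ring

/-! ### Gibbs' inequality and optimal codes. -/

/-- This is `log t ≤ t - 1` at `t = q * l / p`, with equality only at `t = 1`. -/
theorem sub_le_mul_log_sub_log {p q l : ℝ} (hp : 0 < p) (hq : 0 < q) (hl : 0 < l) :
    p - q * l ≤ p * (Real.log (p / l) - Real.log q) ∧
      (p * (Real.log (p / l) - Real.log q) = p - q * l → p = q * l) := by
  have e : Real.log (p / l) - Real.log q = -Real.log (q * l / p) := by
    rw [Real.log_div hp.ne' hl.ne', Real.log_div (mul_pos hq hl).ne' hp.ne',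
      Real.log_mul hq.ne' hl.ne']
    ring
  have ht : 0 < q * l / p := by positivity
  have e2 : p * (q * l / p) = q * l := by field_simp
  rw [e]
  constructor
  · nlinarith [Real.log_le_sub_one_of_pos ht]
  · intro h
    by_contra hne
    have : q * l / p ≠ 1 := fun h1 => hne (by rw [h1, mul_one] at e2; exact e2)
    nlinarith [Real.log_lt_sub_one_of_pos ht this]

/-- Gibbs' inequality for the excess expected message length: it is nonnegative, and vanishes only
if the code for samples that `F` defines is optimal. -/
theorem excessMessageLength_nonneg_and_eq {n : ℕ} {s : Finset (T.Sample n)}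
    (hs : ∀ y ∉ s, T.marginal n y = 0) (F : T.Sample n → T.Param) :
    0 ≤ excessMessageLength n F ∧ (excessMessageLength n F = 0 →
      ∀ y, T.marginal n y ≠ 0 →
        T.marginal n y = estimateProb n F (F y) * T.likelihood n (F y) y) := by
  by_cases hL : ∀ y, T.marginal n y ≠ 0 → T.likelihood n (F y) y ≠ 0
  swap
  · push Not at hL
    obtain ⟨y, h, hy⟩ := hL
    rw [excessMessageLength_eq_top hs h hy]
    exact ⟨le_top, fun h => absurd h (by simp)⟩
  rw [excessMessageLength_eq_coe_sum hs hL]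
  set p := fun y => (T.marginal n y).toReal
  set l := fun y => (T.likelihood n (F y) y).toReal
  set q := fun y => (estimateProb n F (F y)).toReal
  have hpos : ∀ y, T.marginal n y ≠ 0 → 0 < p y ∧ 0 < q y ∧ 0 < l y := fun y h =>
    ⟨ENNReal.toReal_pos h (marginal_ne_top n y),
      ENNReal.toReal_pos ((pos_iff_ne_zero.2 h).trans_le (marginal_le_estimateProb n F y)).ne'
        (estimateProb_ne_top _ _ _),
      ENNReal.toReal_pos (hL y h) (likelihood_ne_top _ _ _)⟩
  have hle : ∀ y ∈ s, p y - q y * l y ≤ p y * (Real.log (p y / l y) - Real.log (q y)) := by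
    intro y _
    by_cases h : T.marginal n y = 0
    · have : p y = 0 := by simp [p, h]
      rw [this, zero_mul, zero_sub, neg_nonpos]
      positivity
    · obtain ⟨h1, h2, h3⟩ := hpos y h
      exact (sub_le_mul_log_sub_log h1 h2 h3).1
  have hsum : 0 ≤ ∑ y ∈ s, (p y - q y * l y) := by
    rw [Finset.sum_sub_distrib, sum_toReal_marginal hs, sub_nonneg]
    exact sum_estimateProb_mul_likelihood_le_one n s F
  refine ⟨EReal.coe_nonneg.2 (hsum.trans (Finset.sum_le_sum hle)), fun h y hy => ?_⟩
  rw [EReal.coe_eq_zero] at h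
  have heq := (Finset.sum_eq_sum_iff_of_le hle).1
    (le_antisymm (Finset.sum_le_sum hle) (h.trans_le hsum)) y
      (by_contra fun hys => hy (hs y hys))
  obtain ⟨h1, h2, h3⟩ := hpos y hy
  have := (sub_le_mul_log_sub_log h1 h2 h3).2 heq.symm
  rw [← ENNReal.toReal_eq_toReal_iff' (marginal_ne_top n y)
    (ENNReal.mul_ne_top (estimateProb_ne_top _ _ _) (likelihood_ne_top _ _ _)), ENNReal.toReal_mul]
  exact this

/-- A parameter under which the sample has its marginal distribution gives a constant estimate
without excess message length. -/
theorem excessMessageLength_const {n : ℕ} {s : Finset (T.Sample n)}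
    (hs : ∀ y ∉ s, T.marginal n y = 0) {θ : T.Param}
    (h : ∀ y, T.likelihood n θ y = T.marginal n y) :
    excessMessageLength n (fun _ => θ) = 0 := by
  have hq : estimateProb n (fun _ => θ) θ = 1 := by
    simp [estimateProb, tsum_marginal]
  rw [excessMessageLength_eq_coe_sum hs fun y hy => by rwa [h y]]
  rw [EReal.coe_eq_zero]
  refine Finset.sum_eq_zero fun y _ => ?_
  rw [h y, hq]
  by_cases hy : T.marginal n y = 0
  · simp [hy]
  · rw [div_self (ENNReal.toReal_pos hy (marginal_ne_top n y)).ne']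
    simp

theorem likelihood_eq_zero_of_marginal_eq_zero {n : ℕ} {y : T.Sample n}
    (h : T.marginal n y = 0) (θ : T.Param) : T.likelihood n θ y = 0 := by
  have h0 : T.prior θ * T.likelihood n θ y = 0 := ENNReal.tsum_eq_zero.1 h θ
  exact (mul_eq_zero.1 h0).resolve_left (T.prior_pos θ).ne'

/-- If the code for samples defined by `F` is optimal, then a parameter which is an estimate with
positive probability is the estimate for every sample it can generate. -/
theorem eq_and_marginal_eq_of_optimal {n : ℕ} {F : T.Sample n → T.Param}
    (h : ∀ y, T.marginal n y ≠ 0 →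
      T.marginal n y = estimateProb n F (F y) * T.likelihood n (F y) y)
    {θ : T.Param} (hθ : estimateProb n F θ ≠ 0) {y : T.Sample n}
    (hy : T.likelihood n θ y ≠ 0) :
    F y = θ ∧ T.marginal n y = estimateProb n F θ * T.likelihood n θ y := by
  classical
  have h' : ∀ z, T.marginal n z = estimateProb n F (F z) * T.likelihood n (F z) z := by
    intro z
    by_cases hz : T.marginal n z = 0
    · rw [hz, likelihood_eq_zero_of_marginal_eq_zero hz, mul_zero]
    · exact h z hz
  have hF : F y = θ := by
    by_contra hne
    -- Summing the optimality identity over the fibre of `θ` shows that `P_θ` gives this fibre mass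
    -- 1; a sample of positive likelihood outside it would push the total above 1.
    have h1 : estimateProb n F θ * ∑' z, (if F z = θ then T.likelihood n θ z else 0) =
        estimateProb n F θ * 1 := by
      rw [mul_one, ← ENNReal.tsum_mul_left]
      nth_rewrite 2 [estimateProb]
      refine tsum_congr fun z => ?_
      split_ifs with hz
      · rw [h' z, hz]
      · rw [mul_zero]
    rw [ENNReal.mul_right_inj hθ (estimateProb_ne_top n F θ)] at h1
    have h2 : ∑' z, (if F z = θ then T.likelihood n θ z else 0) <
        ∑' z, T.likelihood n θ z := by
      refine ENNReal.tsum_lt_tsum (i := y) (by rw [h1]; exact ENNReal.one_ne_top)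
        (fun z => ?_) ?_
      · split_ifs
        exacts [le_rfl, zero_le]
      · rw [if_neg hne]
        exact pos_iff_ne_zero.2 hy
    rw [h1, tsum_likelihood] at h2
    exact lt_irrefl _ h2
  exact ⟨hF, by rw [h' y, hF]⟩

end EstimationProblem

/-! ### The laws of the counterexample. -/

noncomputable section

namespace SMMLCounterexample

/-- The natural numbers as points of the Euclidean line. They serve both as parameters and as
values of the observations. -/
def naturalPoints : Set (EuclideanSpace ℝ (Fin 1)) := Set.range fun k : ℕ => !₂[(k : ℝ)]

theorem naturalPoint_injective :
    Function.Injective fun k : ℕ => (!₂[(k : ℝ)] : EuclideanSpace ℝ (Fin 1)) := by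
  intro a b h
  have := congrArg (fun v : EuclideanSpace ℝ (Fin 1) => v 0) h
  simpa using this

/-- The numbering of `naturalPoints`. -/
def sym : ℕ ≃ naturalPoints := Equiv.ofInjective _ naturalPoint_injective

theorem sym_coordinate (k : ℕ) : (sym k).1 0 = (k : ℝ) := rfl

instance : Countable naturalPoints := sym.symm.injective.countable

/-- The weights `2 ^ (-k - 1)`. -/
def weight (k : ℕ) : ℝ≥0∞ := 2⁻¹ ^ (k + 1)

theorem tsum_weight : ∑' k, weight k = 1 := by
  simp only [weight, ENNReal.tsum_geometric_add_one, ENNReal.one_sub_inv_two, inv_inv]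
  exact ENNReal.inv_mul_cancel two_ne_zero ENNReal.ofNat_ne_top

theorem weight_ne_zero (k : ℕ) : weight k ≠ 0 := by simp [weight]

theorem weight_ne_top (k : ℕ) : weight k ≠ ∞ := by simp [weight]

theorem two_mul_weight_zero : 2 * weight 0 = 1 := by
  simp [weight, ENNReal.mul_inv_cancel]

theorem two_mul_weight_succ (k : ℕ) : 2 * weight (k + 1) = weight k := by
  rw [weight, weight, pow_succ' _ (k + 1), ← mul_assoc,
    ENNReal.mul_inv_cancel two_ne_zero ENNReal.ofNat_ne_top, one_mul]

theorem four_mul_weight_zero : 4 * weight 0 = 2 := by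
  rw [show (4 : ℝ≥0∞) = 2 * 2 by norm_num, mul_assoc, two_mul_weight_zero, mul_one]

theorem four_mul_weight_one : 4 * weight 1 = 1 := by
  rw [show (4 : ℝ≥0∞) = 2 * 2 by norm_num, mul_assoc, two_mul_weight_succ, two_mul_weight_zero]

theorem weight_antitone : Antitone weight :=
  antitone_nat_of_succ_le fun k => by
    rw [← two_mul_weight_succ k]
    exact le_mul_of_one_le_left zero_le one_le_two

/-- The total weight of the numbers below `m`. -/
def totalWeight (m : ℕ) : ℝ≥0∞ := ∑ j ∈ Finset.range m, weight j

theorem totalWeight_ne_top (m : ℕ) : totalWeight m ≠ ∞ :=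
  ENNReal.sum_ne_top.2 fun j _ => weight_ne_top j

theorem totalWeight_ne_zero {m : ℕ} (hm : m ≠ 0) : totalWeight m ≠ 0 := fun h =>
  weight_ne_zero 0 (Finset.sum_eq_zero_iff.1 h 0 (Finset.mem_range.2 (Nat.pos_of_ne_zero hm)))

/-- The sequence which is `1` before time `k` and `0` from time `k` on. -/
def stepSeq (k : ℕ) : ℕ → naturalPoints := fun i => if i < k then sym 1 else sym 0

/-- The law of `stepSeq k` for `k` with distribution `weight`. -/
def stepLaw : Measure (ℕ → naturalPoints) :=
  Measure.sum fun k => weight k • Measure.dirac (stepSeq k)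

/-- Replace all terms of a sequence from time `m` on by `m`. -/
def switch (m : ℕ) (x : ℕ → naturalPoints) : ℕ → naturalPoints :=
  fun i => if i < m then x i else sym m

theorem measurable_switch (m : ℕ) : Measurable (switch m) := by
  refine measurable_pi_lambda _ fun i => ?_
  unfold switch
  split_ifs
  exacts [measurable_pi_apply i, measurable_const]

/-- The law with number `m`, given the weighted sum of the preceding laws. -/
def nextLaw (m : ℕ) (ν : Measure (ℕ → naturalPoints)) : Measure (ℕ → naturalPoints) :=
  if m = 0 then stepLaw else (totalWeight m)⁻¹ • ν.map (switch m)

/-- The weighted sum of the first `m` laws. -/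
def partialMixture : ℕ → Measure (ℕ → naturalPoints)
  | 0 => 0
  | m + 1 => partialMixture m + weight m • nextLaw m (partialMixture m)

/-- The distributions of the counterexample: `seqLaw 0` is `stepLaw`, and `seqLaw m` for `m ≥ 1`
is the law of `switch m x` for `x` drawn from the normalized mixture of the preceding laws. -/
def seqLaw (m : ℕ) : Measure (ℕ → naturalPoints) := nextLaw m (partialMixture m)

theorem partialMixture_eq_sum (m : ℕ) :
    partialMixture m = ∑ j ∈ Finset.range m, weight j • seqLaw j := by
  induction m with
  | zero => rfl
  | succ m ih => rw [Finset.sum_range_succ, ← ih]; rfl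

theorem seqLaw_zero : seqLaw 0 = stepLaw := rfl

theorem totalWeight_mul_seqLaw {m : ℕ} (hm : m ≠ 0) {A : Set (ℕ → naturalPoints)}
    (hA : MeasurableSet A) :
    totalWeight m * seqLaw m A =
      ∑ j ∈ Finset.range m, weight j * seqLaw j (switch m ⁻¹' A) := by
  rw [seqLaw, nextLaw, if_neg hm, Measure.smul_apply, Measure.map_apply (measurable_switch m) hA,
    smul_eq_mul, ← mul_assoc,
    ENNReal.mul_inv_cancel (totalWeight_ne_zero hm) (totalWeight_ne_top m), one_mul,
    partialMixture_eq_sum, Measure.finsetSum_apply]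
  rfl

theorem seqLaw_eq_zero {m : ℕ} (hm : m ≠ 0) {A : Set (ℕ → naturalPoints)}
    (hA : MeasurableSet A) (h : ∀ j < m, seqLaw j (switch m ⁻¹' A) = 0) : seqLaw m A = 0 := by
  have := totalWeight_mul_seqLaw hm hA
  rw [Finset.sum_eq_zero fun j hj => by rw [h j (Finset.mem_range.1 hj), mul_zero]] at this
  exact (mul_eq_zero.1 this).resolve_left (totalWeight_ne_zero hm)

theorem stepLaw_apply {A : Set (ℕ → naturalPoints)} (hA : MeasurableSet A) :
    stepLaw A = ∑' k, weight k * A.indicator 1 (stepSeq k) := by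
  rw [stepLaw, Measure.sum_apply _ hA]
  refine tsum_congr fun k => ?_
  rw [Measure.smul_apply, Measure.dirac_apply' _ hA, smul_eq_mul]

theorem weight_le_stepLaw {A : Set (ℕ → naturalPoints)} (hA : MeasurableSet A) {k : ℕ}
    (h : stepSeq k ∈ A) : weight k ≤ stepLaw A := by
  rw [stepLaw_apply hA]
  refine le_trans ?_ (ENNReal.le_tsum k)
  rw [Set.indicator_of_mem h, Pi.one_apply, mul_one]

theorem stepLaw_eq_zero {A : Set (ℕ → naturalPoints)} (hA : MeasurableSet A)
    (h : ∀ k, stepSeq k ∉ A) : stepLaw A = 0 := by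
  rw [stepLaw_apply hA]
  exact ENNReal.tsum_eq_zero.2 fun k => by rw [Set.indicator_of_notMem (h k), mul_zero]

theorem seqLaw_univ (m : ℕ) : seqLaw m Set.univ = 1 := by
  induction m using Nat.strong_induction_on with
  | _ m ih =>
    by_cases hm : m = 0
    · subst hm
      rw [seqLaw_zero, stepLaw_apply MeasurableSet.univ]
      simp [tsum_weight]
    · have h := totalWeight_mul_seqLaw hm MeasurableSet.univ
      rw [Finset.sum_congr rfl fun j hj => by
        rw [Set.preimage_univ, ih j (Finset.mem_range.1 hj), mul_one]] at h
      change _ = totalWeight m at h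
      rwa [ENNReal.mul_eq_left (totalWeight_ne_zero hm) (totalWeight_ne_top m)] at h

theorem seqLaw_le_one (m : ℕ) (A : Set (ℕ → naturalPoints)) : seqLaw m A ≤ 1 :=
  (measure_mono (Set.subset_univ A)).trans_eq (seqLaw_univ m)

theorem seqLaw_ne_top (m : ℕ) (A : Set (ℕ → naturalPoints)) : seqLaw m A ≠ ∞ :=
  ((seqLaw_le_one m A).trans_lt ENNReal.one_lt_top).ne

theorem measurableSet_apply_mem (i : ℕ) (B : Set naturalPoints) :
    MeasurableSet {x : ℕ → naturalPoints | x i ∈ B} :=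
  measurable_pi_apply i B.to_countable.measurableSet

theorem seqLaw_apply_ne {m i : ℕ} (hm : m ≠ 0) (hi : m ≤ i) :
    seqLaw m {x | x i ≠ sym m} = 0 := by
  refine seqLaw_eq_zero hm (measurableSet_apply_mem i {sym m}ᶜ) fun j _ => ?_
  convert measure_empty (μ := seqLaw j)
  ext x
  simp [switch, hi.not_gt]

/-- A symbol other than 0 and 1 enters only by the switch to it, and law `m` involves only switches
to numbers up to `m`. The bound `1 < k` is needed for `m = 0`, where the symbol 1 occurs. -/
theorem seqLaw_apply_eq_of_lt {m k : ℕ} (hm : m < k) (hk : 1 < k) (i : ℕ) :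
    seqLaw m {x | x i = sym k} = 0 := by
  induction m using Nat.strong_induction_on with
  | _ m ih =>
    by_cases h0 : m = 0
    · subst h0
      refine stepLaw_eq_zero (measurableSet_apply_mem i {sym k}) fun j => ?_
      simp only [Set.mem_ofPred_eq, stepSeq]
      split_ifs <;> simp <;> omega
    · refine seqLaw_eq_zero h0 (measurableSet_apply_mem i {sym k}) fun j hj => ?_
      by_cases hi : i < m
      · convert ih j hj (hj.trans hm) using 2
        ext x
        simp [switch, hi]
      · convert measure_empty (μ := seqLaw j)
        ext x
        simp [switch, hi, hm.ne]

theorem ae_eventually_eq (m : ℕ) : ∀ᵐ x ∂(seqLaw m), ∃ k, ∀ i ≥ k, x i = sym m := by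
  by_cases hm : m = 0
  · subst hm
    rw [seqLaw_zero, stepLaw, Measure.ae_sum_iff]
    refine fun k => Measure.ae_smul_measure ?_ _
    rw [ae_dirac_eq]
    exact ⟨k, fun i hi => by simp [stepSeq, not_lt.2 hi]⟩
  · have : ∀ᵐ x ∂(seqLaw m), ∀ i, m ≤ i → x i = sym m := by
      refine ae_all_iff.2 fun i => ?_
      by_cases hi : m ≤ i
      · filter_upwards [show ∀ᵐ x ∂(seqLaw m), x i = sym m from seqLaw_apply_ne hm hi] with x hx _
        exact hx
      · exact ae_of_all _ fun x h => absurd h hi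
    filter_upwards [this] with x hx
    exact ⟨m, hx⟩

/-- Sequences drawn from different laws almost surely have different eventual values. -/
theorem seqLaw_injective : Function.Injective seqLaw := by
  have key : ∀ a b, b ≠ 0 → a ≠ b → seqLaw a ≠ seqLaw b := by
    intro a b hb hab h
    have ha := ae_eventually_eq a
    have hb' := ae_eventually_eq b
    rw [← h] at hb'
    have : NeZero (seqLaw a) := ⟨fun h0 => by simpa [h0] using seqLaw_univ a⟩
    obtain ⟨x, ⟨k, hk⟩, l, hl⟩ := (ha.and hb').exists
    exact hab (sym.injective ((hk (max k l) (le_max_left _ _)).symm.trans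
      (hl (max k l) (le_max_right _ _))))
  intro a b h
  by_contra hab
  by_cases hb : b = 0
  · exact key b a (fun ha => hab (ha.trans hb.symm)) (Ne.symm hab) h.symm
  · exact key a b hb hab h

/-! ### Cylinder probabilities: marginals and likelihood ratios. -/

/-- The sequences whose first `n` terms are `y`. -/
def cylinder (n : ℕ) (y : Fin n → naturalPoints) : Set (ℕ → naturalPoints) :=
  {x | (fun i : Fin n => x i) = y}

theorem measurableSet_cylinder (n : ℕ) (y : Fin n → naturalPoints) :
    MeasurableSet (cylinder n y) :=
  measurableSet_eq_fun (measurable_pi_lambda _ fun i : Fin n => measurable_pi_apply (i : ℕ))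
    measurable_const

theorem switch_preimage_cylinder {n m : ℕ} (h : n ≤ m) (y : Fin n → naturalPoints) :
    switch m ⁻¹' cylinder n y = cylinder n y := by
  ext x
  have : (fun i : Fin n => switch m x i) = fun i : Fin n => x i :=
    funext fun i => if_pos (i.2.trans_le h)
  simp only [cylinder, Set.mem_preimage, Set.mem_ofPred_eq, this]

theorem totalWeight_mul_seqLaw_cylinder {n m : ℕ} (hm : m ≠ 0) (h : n ≤ m)
    (y : Fin n → naturalPoints) :
    totalWeight m * seqLaw m (cylinder n y) =
      ∑ j ∈ Finset.range m, weight j * seqLaw j (cylinder n y) := by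
  rw [totalWeight_mul_seqLaw hm (measurableSet_cylinder n y), switch_preimage_cylinder h]

/-- On the first `n` terms, law `m + 1` is the mixture of laws `0, ..., m`. The first `m` of them
already average to law `m`, so adding law `m` itself changes nothing. -/
theorem seqLaw_cylinder_eq {n m : ℕ} (hn : n ≠ 0) (h : n ≤ m) (y : Fin n → naturalPoints) :
    seqLaw m (cylinder n y) = seqLaw n (cylinder n y) := by
  induction m, h using Nat.le_induction with
  | base => rfl
  | succ m h ih =>
    rw [← ih, ← ENNReal.mul_right_inj (totalWeight_ne_zero m.succ_ne_zero)
      (totalWeight_ne_top (m + 1)), totalWeight_mul_seqLaw_cylinder m.succ_ne_zero (by omega),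
      Finset.sum_range_succ, ← totalWeight_mul_seqLaw_cylinder (by omega) h, ← add_mul,
      totalWeight, totalWeight, ← Finset.sum_range_succ]

theorem tsum_weight_mul_seqLaw_cylinder {n : ℕ} (hn : n ≠ 0) (y : Fin n → naturalPoints) :
    ∑' j, weight j * seqLaw j (cylinder n y) = seqLaw n (cylinder n y) := by
  rw [← ENNReal.summable.sum_add_tsum_nat_add' (k := n),
    ← totalWeight_mul_seqLaw_cylinder hn le_rfl]
  simp_rw [fun j => seqLaw_cylinder_eq hn (Nat.le_add_left n j) y]
  rw [ENNReal.tsum_mul_right, ← add_mul, totalWeight, ENNReal.summable.sum_add_tsum_nat_add',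
    tsum_weight, one_mul]

theorem seqLaw_cylinder_eq_zero {n m i : ℕ} (hi : i < n) (hm : m ≠ 0) (hmi : m ≤ i)
    {y : Fin n → naturalPoints} (hy : y ⟨i, hi⟩ ≠ sym m) : seqLaw m (cylinder n y) = 0 := by
  refine measure_mono_null (fun x hx => ?_) (seqLaw_apply_ne hm hmi)
  rw [Set.mem_ofPred_eq, show x i = y ⟨i, hi⟩ from congrFun hx ⟨i, hi⟩]
  exact hy

/-- A lower bound independent of `n`: the single path `stepSeq 1`, a one followed by zeros, becomes
all ones after the switch at time 1. -/
theorem seqLaw_one_cylinder (n : ℕ) :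
    weight 1 ≤ seqLaw 1 (cylinder n fun _ => sym 1) := by
  have h := totalWeight_mul_seqLaw one_ne_zero (measurableSet_cylinder n fun _ => sym 1)
  simp only [totalWeight, Finset.sum_range_one] at h
  rw [ENNReal.mul_right_inj (weight_ne_zero 0) (weight_ne_top 0)] at h
  rw [h]
  refine weight_le_stepLaw (measurable_switch 1 (measurableSet_cylinder n _)) ?_
  refine funext fun i => ?_
  by_cases hi : (i : ℕ) < 1 <;> simp [switch, stepSeq, hi]

/-- Law 0 can end in `m ≠ 0` only for `m = 1` and the all-ones sample. That needs at least `n ≥ 3`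
initial ones, of probability at most `weight 2`, half of the `weight 1` guaranteed under law 1. -/
theorem two_mul_stepLaw_cylinder_le {n m : ℕ} (hn : 3 ≤ n) (hm : m ≠ 0)
    {y : Fin n → naturalPoints} (hy : y ⟨n - 1, by omega⟩ = sym m) :
    2 * stepLaw (cylinder n y) ≤ seqLaw m (cylinder n y) := by
  by_cases h : ∃ k, stepSeq k ∈ cylinder n y
  · obtain ⟨k, hk⟩ := h
    have hlast : stepSeq k (n - 1) = sym m := (congrFun hk ⟨n - 1, by omega⟩).trans hy
    have hkn : n ≤ k := by
      by_contra hlt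
      rw [stepSeq, if_neg (by omega)] at hlast
      exact hm (sym.injective hlast).symm
    have hm1 : m = 1 := by
      rw [stepSeq, if_pos (by omega)] at hlast
      exact (sym.injective hlast).symm
    subst hm1
    have hy1 : y = fun _ => sym 1 := by
      rw [← show _ = y from hk]
      exact funext fun i => if_pos (i.2.trans_le hkn)
    subst hy1
    refine le_trans ?_ (seqLaw_one_cylinder n)
    rw [← two_mul_weight_succ 1]
    gcongr
    rw [stepLaw_apply (measurableSet_cylinder _ _),
      ← ENNReal.summable.sum_add_tsum_nat_add' (k := 3)]
    rw [Finset.sum_eq_zero fun j hj => ?_, zero_add]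
    · calc _ ≤ ∑' j, weight (j + 3) := ENNReal.tsum_le_tsum fun j =>
            mul_le_of_le_one_right zero_le
              (Set.indicator_le_self' (f := (1 : (ℕ → naturalPoints) → ℝ≥0∞))
                (fun _ _ => zero_le) _)
        _ = ∑' j, weight j * weight 2 := tsum_congr fun j => by
            rw [weight, weight, weight, ← pow_add]
        _ = weight 2 := by rw [ENNReal.tsum_mul_right, tsum_weight, one_mul]
        _ ≤ _ := le_rfl
    · rw [Set.indicator_of_notMem, mul_zero]
      intro hmem
      have := congrFun hmem ⟨n - 1, by omega⟩
      rw [Finset.mem_range] at hj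
      simp only [stepSeq] at this
      rw [if_neg (by omega)] at this
      exact one_ne_zero (sym.injective this).symm
  · push Not at h
    rw [stepLaw_eq_zero (measurableSet_cylinder n y) h, mul_zero]
    exact zero_le

/-- Among the laws below `n`, only 0 and `m` can produce the last symbol `m`. A law with index at
least `n` has the mixture likelihood, which is then controlled by these two. -/
theorem three_mul_seqLaw_cylinder_le {n m j : ℕ} (hn : 3 ≤ n) (hm : m < n) (hj : j ≠ m)
    {y : Fin n → naturalPoints} (hy : y ⟨n - 1, by omega⟩ = sym m) :
    3 * seqLaw j (cylinder n y) ≤ 2 * seqLaw m (cylinder n y) := by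
  have hzero : ∀ k < n, k ≠ 0 → k ≠ m → seqLaw k (cylinder n y) = 0 := fun k hk h0 hkm =>
    seqLaw_cylinder_eq_zero (i := n - 1) (by omega) h0 (by omega)
      (by rw [hy]; exact fun h => hkm (sym.injective h).symm)
  rcases lt_or_ge j n with hjn | hjn
  · by_cases hj0 : j = 0
    · subst hj0
      have h2 := two_mul_stepLaw_cylinder_le hn hj.symm hy
      rw [seqLaw_zero]
      calc 3 * stepLaw (cylinder n y) ≤ 2 * (2 * stepLaw (cylinder n y)) := by
            rw [← mul_assoc]; gcongr; norm_num
        _ ≤ _ := by gcongr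
    · rw [hzero j hjn hj0 hj, mul_zero]
      exact zero_le
  · rw [seqLaw_cylinder_eq (by omega) hjn]
    -- The normalizer is at least 1/2 + 1/4 = 3/4, hence the factors 4 and 3.
    have hs : weight 0 + weight 1 ≤ totalWeight n := by
      rw [show weight 0 + weight 1 = ∑ k ∈ Finset.range 2, weight k by
        simp [Finset.sum_range_succ]]
      exact Finset.sum_le_sum_of_subset (Finset.range_mono (by omega))
    have hsum : 4 * ∑ k ∈ Finset.range n, weight k * seqLaw k (cylinder n y) ≤
        2 * seqLaw m (cylinder n y) := by
      by_cases hm0 : m = 0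
      · subst hm0
        rw [Finset.sum_eq_single 0 (fun k hk h0 => by
          rw [hzero k (Finset.mem_range.1 hk) h0 h0, mul_zero])
          (fun h => absurd (Finset.mem_range.2 hm) h), ← mul_assoc, four_mul_weight_zero]
      · rw [Finset.sum_eq_add_of_mem 0 m (Finset.mem_range.2 (by omega)) (Finset.mem_range.2 hm)
          (Ne.symm hm0) (fun k hk h => by
            rw [hzero k (Finset.mem_range.1 hk) h.1 h.2, mul_zero]), mul_add, ← mul_assoc,
          ← mul_assoc, four_mul_weight_zero, two_mul (seqLaw m _), seqLaw_zero]
        refine add_le_add (two_mul_stepLaw_cylinder_le hn hm0 hy) ?_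
        refine mul_le_of_le_one_left zero_le ?_
        rw [← four_mul_weight_one]
        gcongr
        exact weight_antitone (by omega)
    calc 3 * seqLaw n (cylinder n y)
        = 4 * (weight 0 + weight 1) * seqLaw n (cylinder n y) := by
          rw [mul_add, four_mul_weight_zero, four_mul_weight_one]; norm_num
      _ ≤ 4 * totalWeight n * seqLaw n (cylinder n y) := by gcongr
      _ = 4 * ∑ k ∈ Finset.range n, weight k * seqLaw k (cylinder n y) := by
          rw [mul_assoc, totalWeight_mul_seqLaw_cylinder (by omega) le_rfl]
      _ ≤ _ := hsum

/-! ### The estimation problem and its SMML estimators. -/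

/-- A problem with distinctive likelihoods on which strict minimum message length estimators are
inconsistent. -/
abbrev problem : EstimationProblem where
  paramDim := 1
  Param := naturalPoints
  countable_param := Set.countable_range _
  obsDim _ := 1
  Obs _ := naturalPoints
  countable_obs _ := Set.countable_range _
  law θ := seqLaw (sym.symm θ)
  isProbabilityMeasure_law θ := ⟨seqLaw_univ _⟩
  law_injective := seqLaw_injective.comp sym.symm.injective
  prior := ⟨fun θ => weight (sym.symm θ), by
    rw [ENNReal.summable.hasSum_iff, Equiv.tsum_eq sym.symm weight, tsum_weight]⟩
  prior_pos θ := pos_iff_ne_zero.2 (weight_ne_zero _)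

open EstimationProblem

theorem likelihood_sym (n m : ℕ) (y : problem.Sample n) :
    problem.likelihood n (sym m) y = seqLaw m (cylinder n y) := by
  unfold likelihood
  rw [show problem.law (sym m) = seqLaw m from congrArg seqLaw (sym.symm_apply_apply m)]
  rfl

theorem prior_sym (m : ℕ) : problem.prior (sym m) = weight m :=
  congrArg weight (sym.symm_apply_apply m)

theorem marginal_eq {n : ℕ} (hn : n ≠ 0) (y : problem.Sample n) :
    problem.marginal n y = seqLaw n (cylinder n y) := by
  unfold marginal
  rw [← tsum_weight_mul_seqLaw_cylinder hn, ← Equiv.tsum_eq sym]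
  exact tsum_congr fun m => by rw [likelihood_sym, prior_sym]

/-- The marginal is that of law `n`, whose symbols almost surely lie in `{0, ..., n}`. -/
theorem exists_finset_marginal_eq_zero {n : ℕ} (hn : n ≠ 0) :
    ∃ s : Finset (problem.Sample n), ∀ y ∉ s, problem.marginal n y = 0 := by
  have hfin : {y : Fin n → naturalPoints | ∀ i, y i ∈ sym '' Set.Iic n}.Finite :=
    Set.Finite.pi' fun _ => (Set.finite_Iic n).image _
  refine ⟨hfin.toFinset, fun y hy => ?_⟩
  rw [Set.Finite.mem_toFinset, Set.mem_ofPred_eq] at hy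
  push Not at hy
  obtain ⟨i, hi⟩ := hy
  obtain ⟨k, hk⟩ := sym.surjective (y i)
  have hkn : n < k := by
    by_contra h
    exact hi ⟨k, not_lt.1 h, hk⟩
  rw [marginal_eq hn]
  refine measure_mono_null (fun x hx => ?_) (seqLaw_apply_eq_of_lt hkn (by omega) i)
  exact (congrFun hx i).trans hk.symm

theorem isSMML_iff (est : problem.Estimator) :
    IsSMML est ↔ ∀ n, 1 ≤ n → excessMessageLength n (est n) = 0 := by
  refine forall_congr' fun n => forall_congr' fun hn => ?_
  obtain ⟨s, hs⟩ := exists_finset_marginal_eq_zero (n := n) (by omega)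
  have : ⨅ F : problem.Sample n → problem.Param, excessMessageLength n F = 0 := by
    refine le_antisymm ?_ (le_iInf fun F => (excessMessageLength_nonneg_and_eq hs F).1)
    refine iInf_le_of_le (fun _ => sym n) (excessMessageLength_const hs fun y => ?_).le
    rw [likelihood_sym, marginal_eq (by omega)]
  rw [this]

theorem exists_isSMML : ∃ est : problem.Estimator, IsSMML est := by
  refine ⟨fun n _ => sym n, (isSMML_iff _).2 fun n hn => ?_⟩
  obtain ⟨s, hs⟩ := exists_finset_marginal_eq_zero (n := n) (by omega)
  refine excessMessageLength_const hs fun y => ?_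
  rw [likelihood_sym, marginal_eq (by omega)]

theorem estimateProb_sym_zero_eq_zero {n : ℕ} (hn : 2 ≤ n) {F : problem.Sample n → problem.Param}
    (hF : excessMessageLength n F = 0) : estimateProb n F (sym 0) = 0 := by
  by_contra hq
  obtain ⟨s, hs⟩ := exists_finset_marginal_eq_zero (n := n) (by omega)
  have hopt := (excessMessageLength_nonneg_and_eq hs F).2 hF
  have key : ∀ y : Fin n → naturalPoints, stepLaw (cylinder n y) ≠ 0 →
      totalWeight n * estimateProb n F (sym 0) * stepLaw (cylinder n y) =
        ∑ j ∈ Finset.range n, weight j * seqLaw j (cylinder n y) := by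
    intro y hy
    have h := (eq_and_marginal_eq_of_optimal hopt hq (y := y)
      (by rw [likelihood_sym]; exact hy)).2
    rw [marginal_eq (by omega), likelihood_sym, seqLaw_zero] at h
    rw [mul_assoc, ← h, totalWeight_mul_seqLaw_cylinder (by omega) le_rfl]
  have h0 : stepLaw (cylinder n fun _ => sym 0) ≠ 0 :=
    ((pos_iff_ne_zero.2 (weight_ne_zero 0)).trans_le
      (weight_le_stepLaw (k := 0) (measurableSet_cylinder _ _) (by
        exact funext fun i => by simp [stepSeq]))).ne'
  have h1 : stepLaw (cylinder n fun _ => sym 1) ≠ 0 :=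
    ((pos_iff_ne_zero.2 (weight_ne_zero n)).trans_le
      (weight_le_stepLaw (k := n) (measurableSet_cylinder _ _) (by
        exact funext fun i => by simp [stepSeq]))).ne'
  -- The all-zeros sample comes from law 0 alone among the laws below `n`, which forces the
  -- proportionality constant to be `weight 0`.
  have e0 := key _ h0
  rw [Finset.sum_eq_single 0 (fun j hj hj0 => by
      rw [seqLaw_cylinder_eq_zero (i := n - 1) (by omega) hj0
        (by have := Finset.mem_range.1 hj; omega) (fun h => hj0 (sym.injective h).symm), mul_zero])
      (fun h => absurd (Finset.mem_range.2 (by omega)) h), seqLaw_zero,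
    ENNReal.mul_left_inj h0 (seqLaw_ne_top 0 _)] at e0
  have e1 := key _ h1
  rw [e0] at e1
  -- On the all-ones sample that constant leaves no room for the positive contribution of law 1,
  -- which is in the sum because `2 ≤ n`.
  have h2 : ∑ j ∈ Finset.range 2, weight j * seqLaw j (cylinder n fun _ => sym 1) ≤
      weight 0 * stepLaw (cylinder n fun _ => sym 1) := by
    rw [e1]
    exact Finset.sum_le_sum_of_subset (Finset.range_mono hn)
  rw [Finset.sum_range_succ, Finset.sum_range_one, seqLaw_zero] at h2
  have h3 := ENNReal.lt_add_right
    (ENNReal.mul_ne_top (weight_ne_top 0) (seqLaw_ne_top 0 (cylinder n fun _ => sym 1)))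
    (mul_ne_zero (weight_ne_zero 1) (((pos_iff_ne_zero.2 (weight_ne_zero 1)).trans_le
      (seqLaw_one_cylinder n)).ne'))
  exact absurd h3 h2.not_gt

theorem not_isConsistent {est : problem.Estimator} (h : IsSMML est) : ¬ IsConsistent est := by
  intro hc
  rw [isSMML_iff] at h
  -- This neighbourhood contains no parameter but 0, so consistency would require estimating exactly
  -- 0.
  have hU : {θ : naturalPoints | θ.1 0 < 1} ∈ 𝓝 (show problem.Param from sym 0) := by
    refine IsOpen.mem_nhds ?_ ?_
    · exact isOpen_lt (by fun_prop) continuous_const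
    · change (sym 0).1 0 < 1
      rw [sym_coordinate, Nat.cast_zero]
      exact one_pos
  have hU0 : ∀ θ : problem.Param, θ.1 0 < 1 → θ = sym 0 := by
    intro θ hθ
    obtain ⟨k, rfl⟩ := sym.surjective θ
    rw [sym_coordinate] at hθ
    exact congrArg sym (Nat.cast_lt_one.1 hθ)
  obtain ⟨n, hpos, hn⟩ := (((hc (sym 0) _ hU).eventually (lt_mem_nhds one_pos)).and
    (eventually_ge_atTop 2)).exists
  rw [show {x | est n (problem.firstObs n x) ∈ {θ : naturalPoints | θ.1 0 < 1}} =
    {x | problem.firstObs n x ∈ {y | (est n y).1 0 < 1}} from rfl, law_firstObs_mem] at hpos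
  obtain ⟨y, hy⟩ := not_forall.1 fun h0 => hpos.ne' (ENNReal.tsum_eq_zero.2 h0)
  obtain ⟨hyU, hy0⟩ := Set.indicator_apply_ne_zero.1 hy
  have hm : problem.marginal n y ≠ 0 := fun h0 =>
    hy0 (likelihood_eq_zero_of_marginal_eq_zero h0 _)
  have hle := marginal_le_estimateProb n (est n) y
  rw [hU0 _ hyU, estimateProb_sym_zero_eq_zero hn (h n (by omega))] at hle
  exact hm (le_zero_iff.1 hle)

theorem hasDistinctiveLikelihoods : problem.HasDistinctiveLikelihoods := by
  intro θ U hU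
  obtain ⟨m, rfl⟩ := sym.surjective θ
  rw [show problem.law (sym m) = seqLaw m from congrArg seqLaw (sym.symm_apply_apply m)]
  filter_upwards [ae_eventually_eq m] with x ⟨k, hk⟩
  have h32 : (2 / 3 : ℝ≥0∞) < 1 := by
    rw [ENNReal.div_lt_iff (by simp) (by simp)]; norm_num
  refine lt_of_le_of_lt (limsup_le_of_le (by isBoundedDefault) ?_) h32
  -- `k + 1` ensures that the last observation, at index `n - 1`, already equals `m`.
  filter_upwards [eventually_ge_atTop (max 3 (max (m + 1) (k + 1)))] with n hn
  simp only [max_le_iff] at hn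
  refine ENNReal.div_le_of_le_mul (iSup₂_le fun θ' hθ' => ?_)
  obtain ⟨j, rfl⟩ := sym.surjective θ'
  have hj : j ≠ m := by
    rintro rfl
    exact hθ' (mem_of_mem_nhds hU)
  have h3 := three_mul_seqLaw_cylinder_le (y := problem.firstObs n x) hn.1
    (show m < n by omega) hj (hk (n - 1) (by omega))
  calc problem.likelihood n (sym j) (problem.firstObs n x)
      ≤ 2 / 3 * problem.likelihood n (sym m) (problem.firstObs n x) := by
        rw [likelihood_sym, likelihood_sym, mul_comm, ← mul_div_assoc,
          ENNReal.le_div_iff_mul_le (by simp) (by simp), mul_comm, mul_comm _ (2 : ℝ≥0∞)]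
        exact h3
    _ ≤ _ := by
        gcongr
        exact le_iSup₂_of_le (sym m) (mem_of_mem_nhds hU) le_rfl

end SMMLCounterexample

end

theorem theoremT :
    ¬ smmlClass.PartiallyConsistentOver {T | T.HasDistinctiveLikelihoods} ∧
    ∃ T : EstimationProblem, T.HasDistinctiveLikelihoods ∧
      (∃ est : T.Estimator, est ∈ smmlClass T) ∧
      ∀ est ∈ smmlClass T, ¬ EstimationProblem.IsConsistent est := by
  obtain ⟨est, hest⟩ := SMMLCounterexample.exists_isSMML
  refine ⟨fun h => ?_, SMMLCounterexample.problem,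
    SMMLCounterexample.hasDistinctiveLikelihoods, ⟨est, hest⟩,
    fun est h => SMMLCounterexample.not_isConsistent h⟩
  exact SMMLCounterexample.not_isConsistent hest
    (h _ SMMLCounterexample.hasDistinctiveLikelihoods est hest)
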